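/- For real $x>0$ let $\psi(x)=\Gamma'(x)/\Gamma(x)$, and for real $\beta>-1$ let $H_\beta=H^{(1)}_\beta:=\psi(\beta+1)+\gamma$, where $\gamma$ is the Euler–Mascheroni constant, and $H^{(m)}_\beta:=\frac{(-1)^{m-1}}{(m-1)!}\bigl(\psi^{(m-1)}(\beta+1)-\psi^{(m-1)}(1)\bigr)$ for integers $m\ge 2$. Let $0\le r<k$ be integers and let $\alpha>k$ be real. Then the series below converges and $$ \begin{aligned} \sum_{n=1}^\infty \frac{H^{(3)}_{n+\alpha}}{(n+r)(n+k)}=\frac1{k-r}\Bigl\{ &(r-\alpha)\sum_{j=1}^{r}\frac{H^{(3)}_{\alpha+j-r}}{j(\alpha+j-r)} -(k-\alpha)\sum_{j=1}^{k}\frac{H^{(3)}_{\alpha+j-k}}{j(\alpha+j-k)}\\ &-\sum_{j=1}^{k-r}\frac{H^{(2)}_{\alpha+j-k}}{(\alpha+j-k)^2} -\sum_{j=1}^{k-r}\frac{H_{\alpha+j-k}}{(\alpha+j-k)^3} +3\bigl(H^{(4)}_{\alpha-r}-H^{(4)}_{\alpha-k}\bigr)\\ &+\bigl(H^{(2)}_{\alpha-k}-H^{(2)}_{\alpha-r}\bigr)\zeta(2)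 +\bigl(H_{\alpha-k}-H_{\alpha-r}\bigr)\zeta(3)\\ &+\bigl(H^{(2)}_{\alpha-r}\bigr)^2-\bigl(H^{(2)}_{\alpha-k}\bigr)^2 +2\bigl(H_{\alpha-r}H^{(3)}_{\alpha-r}-H_{\alpha-k}H^{(3)}_{\alpha-k}\bigr)\Bigr\}, \end{aligned} $$ where $\zeta$ is the Riemann zeta function and empty sums are $0$. -/

import Mathlib

/-- The digamma function `ψ(x) = Γ'(x) / Γ(x)` of a real variable. -/
noncomputable def realDigamma : ℝ → ℝ := logDeriv Real.Gamma

/-- The shifted harmonic number `H_α^{(m)}` of order `m ≥ 1`, for real `α` not a negative integer: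
`H_α^{(1)} = ψ(α + 1) + γ`, and for `m ≥ 2`
`H_α^{(m)} = (-1)^(m-1) / (m-1)! * (ψ^{(m-1)}(α + 1) - ψ^{(m-1)}(1))`. (The order `m = 0` is not used.) -/
noncomputable def shiftedHarmonic (m : ℕ) (α : ℝ) : ℝ :=
  if m = 1 then realDigamma (α + 1) + Real.eulerMascheroniConstant
  else (-1) ^ (m - 1) / (Nat.factorial (m - 1) : ℝ) *
    (iteratedDeriv (m - 1) realDigamma (α + 1) - iteratedDeriv (m - 1) realDigamma 1)

/-- The value `ζ(s)` of the Riemann zeta function at an integer `s ≥ 2`, as a real number. -/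
noncomputable def realZeta (s : ℕ) : ℝ := (riemannZeta (s : ℂ)).re

open Filter Topology Set

/-! Since `1/((n+r)(n+k))` is `1/(k-r)` times the sum of `1/(n+q) - 1/(n+q+1)` over `r ≤ q < k`,
only consecutive shifts matter. For one `q`, put `β = α - q`. Summation by parts
(`sum_range_shiftedHarmonic_three`) turns differences of `H^(3)` into cubes, leaving `∑
1/(m(m+β)^3)`, which partial fractions evaluate (`hasSum_one_div_mul_add_cube`). The result is `F(q)
- F(q+1)` minus two quotients, with `F` = `shiftedHarmonicClosedForm`, so summing over `q`
telescopes. The analytic input is the series for `ψ` and its derivatives. -/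

/-! ### Recurrence and growth of the digamma function -/

theorem differentiableAt_realGamma {x : ℝ} (hx : 0 < x) : DifferentiableAt ℝ Real.Gamma x :=
  Real.differentiableAt_Gamma fun m => by
    have : (0 : ℝ) ≤ m := m.cast_nonneg
    linarith

theorem realDigamma_add_one {x : ℝ} (hx : 0 < x) :
    realDigamma (x + 1) = realDigamma x + 1 / x := by
  have hΓ := Real.Gamma_pos_of_pos hx
  have hd : deriv Real.Gamma (x + 1) = Real.Gamma x + x * deriv Real.Gamma x := by
    have h1 : HasDerivAt (fun y => Real.Gamma (y + 1)) (deriv Real.Gamma (x + 1)) x :=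
      (differentiableAt_realGamma (by linarith : 0 < x + 1)).hasDerivAt.comp_add_const x 1
    have h2 : HasDerivAt (fun y => y * Real.Gamma y)
        (1 * Real.Gamma x + x * deriv Real.Gamma x) x :=
      (hasDerivAt_id x).mul (differentiableAt_realGamma hx).hasDerivAt
    have h3 : (fun y => Real.Gamma (y + 1)) =ᶠ[𝓝 x] fun y => y * Real.Gamma y := by
      filter_upwards [lt_mem_nhds hx] with y hy using Real.Gamma_add_one hy.ne'
    simpa using (h2.congr_of_eventuallyEq h3).unique h1 |>.symm
  simp only [realDigamma, logDeriv_apply, hd, Real.Gamma_add_one hx.ne']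
  field_simp
  ring

theorem realDigamma_one : realDigamma 1 = -Real.eulerMascheroniConstant := by
  simp [realDigamma, logDeriv_apply, Real.hasDerivAt_Gamma_one.deriv]

/-- `ψ` is the derivative of the convex function `log Γ`. -/
theorem monotoneOn_realDigamma : MonotoneOn realDigamma (Ioi 0) := by
  have hd : ∀ x ∈ Ioi (0 : ℝ), HasDerivAt (Real.log ∘ Real.Gamma) (realDigamma x) x := by
    intro x hx
    exact (differentiableAt_realGamma hx).hasDerivAt.log (Real.Gamma_pos_of_pos hx).ne'
  have hm := Real.convexOn_log_Gamma.monotoneOn_deriv fun x hx => (hd x hx).differentiableAt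
  exact hm.congr fun x hx => (hd x hx).deriv

theorem realDigamma_add_nat {x : ℝ} (hx : 0 < x) (N : ℕ) :
    realDigamma (x + N) = realDigamma x + ∑ i ∈ Finset.range N, 1 / ((i : ℝ) + x) := by
  induction N with
  | zero => simp
  | succ N ih =>
    rw [Finset.sum_range_succ, Nat.cast_succ, ← add_assoc, realDigamma_add_one (by positivity), ih,
      add_comm x]
    ring

theorem tendsto_realDigamma_sub {x : ℝ} (hx : 0 < x) :
    Tendsto (fun N : ℕ => realDigamma (x + N) - realDigamma (1 + N)) atTop (𝓝 0) := by
  -- Monotonicity traps `ψ(x+N)` between `ψ(N)` and `ψ(1+N+M)`; by the recurrence both differ from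
  -- `ψ(1+N)` by boundedly many terms tending to 0.
  obtain ⟨M, hM⟩ := exists_nat_ge x
  have hinv : ∀ a : ℝ, Tendsto (fun N : ℕ => 1 / (a + (N : ℝ))) atTop (𝓝 0) := fun a =>
    tendsto_const_nhds.div_atTop (tendsto_atTop_add_const_left _ _ tendsto_natCast_atTop_atTop)
  have hlow : Tendsto (fun N : ℕ => -(1 / (0 + (N : ℝ)))) atTop (𝓝 0) := by
    simpa using (hinv 0).neg
  have hup : Tendsto (fun N : ℕ => ∑ i ∈ Finset.range M, 1 / ((i : ℝ) + 1 + N)) atTop (𝓝 0) := by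
    simpa using tendsto_finsetSum (Finset.range M) fun (i : ℕ) _ => hinv ((i : ℝ) + 1)
  refine tendsto_of_tendsto_of_tendsto_of_le_of_le' hlow hup ?_ ?_
  · filter_upwards [eventually_gt_atTop 0] with N hN
    have hN' : (0 : ℝ) < N := by exact_mod_cast hN
    have h1 := monotoneOn_realDigamma (mem_Ioi.2 hN') (mem_Ioi.2 (by linarith : 0 < x + N))
      (by linarith)
    have h2 := realDigamma_add_one hN'
    rw [add_comm (N : ℝ) 1] at h2
    rw [zero_add]
    linarith
  · refine Eventually.of_forall fun N => ?_
    have hN : (0 : ℝ) ≤ N := N.cast_nonneg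
    have hM0 : (0 : ℝ) ≤ M := M.cast_nonneg
    have h1 := monotoneOn_realDigamma (mem_Ioi.2 (by linarith : 0 < x + N))
      (mem_Ioi.2 (by linarith : (0 : ℝ) < 1 + N + M)) (by linarith)
    rw [realDigamma_add_nat (by linarith : (0 : ℝ) < 1 + N)] at h1
    simp only [add_assoc]
    linarith

/-- The series `∑ 1 / (n + x) ^ p` over `n ≥ 0`, a Hurwitz zeta value. -/
noncomputable def hurwitzSeries (p : ℕ) (x : ℝ) : ℝ := ∑' n : ℕ, 1 / ((n : ℝ) + x) ^ p

/-! ### Series for the digamma function and its derivatives -/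

theorem summable_one_div_nat_add_pow {p : ℕ} (hp : 2 ≤ p) {x : ℝ} (hx : 0 < x) :
    Summable fun n : ℕ => 1 / ((n : ℝ) + x) ^ p := by
  have h := (Real.summable_one_div_nat_add_rpow x p).2 (by exact_mod_cast hp)
  refine h.congr fun n => ?_
  rw [abs_of_pos (by positivity), Real.rpow_natCast]

theorem hasSum_hurwitzSeries {p : ℕ} (hp : 2 ≤ p) {x : ℝ} (hx : 0 < x) :
    HasSum (fun n : ℕ => 1 / ((n : ℝ) + x) ^ p) (hurwitzSeries p x) :=
  (summable_one_div_nat_add_pow hp hx).hasSum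

theorem hurwitzSeries_eq_add {p : ℕ} (hp : 2 ≤ p) {x : ℝ} (hx : 0 < x) :
    hurwitzSeries p x = 1 / x ^ p + hurwitzSeries p (x + 1) := by
  rw [hurwitzSeries, (summable_one_div_nat_add_pow hp hx).tsum_eq_zero_add, hurwitzSeries]
  simp [add_assoc, add_comm (1 : ℝ)]

theorem summable_one_div_sub_one_div {x : ℝ} (hx : 0 < x) :
    Summable fun n : ℕ => 1 / ((n : ℝ) + 1) - 1 / ((n : ℝ) + x) := by
  have hm : 0 < min x 1 := lt_min hx one_pos
  refine .of_norm_bounded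
    (g := fun n : ℕ => |x - 1| * (1 / ((n : ℝ) + min x 1) ^ 2))
    ((summable_one_div_nat_add_pow le_rfl hm).mul_left _) fun n => ?_
  have hn : (0 : ℝ) ≤ n := n.cast_nonneg
  have h1 : 1 / ((n : ℝ) + 1) - 1 / ((n : ℝ) + x) = (x - 1) * (1 / (((n : ℝ) + 1) * (n + x))) := by
    field_simp
    ring
  rw [h1, Real.norm_eq_abs, abs_mul, abs_of_pos (by positivity : 0 < 1 / (((n : ℝ) + 1) * (n + x))),
    sq]
  gcongr
  · exact min_le_right _ _
  · exact min_le_left _ _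

/-- By the recurrence, the `N`th partial sum misses the limit by exactly `ψ(x+N) - ψ(1+N)`. -/
theorem hasSum_realDigamma {x : ℝ} (hx : 0 < x) :
    HasSum (fun n : ℕ => 1 / ((n : ℝ) + 1) - 1 / ((n : ℝ) + x))
      (realDigamma x + Real.eulerMascheroniConstant) := by
  rw [(summable_one_div_sub_one_div hx).hasSum_iff_tendsto_nat]
  have h := (tendsto_realDigamma_sub hx).const_sub
    (realDigamma x + Real.eulerMascheroniConstant)
  rw [sub_zero] at h
  refine h.congr fun N => ?_
  rw [realDigamma_add_nat hx, realDigamma_add_nat one_pos, realDigamma_one,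
    Finset.sum_sub_distrib]
  ring

theorem hasDerivAt_one_div_add_pow (a : ℝ) (p : ℕ) {x : ℝ} (hx : a + x ≠ 0) :
    HasDerivAt (fun y => 1 / (a + y) ^ p) (-p * (1 / (a + x) ^ (p + 1))) x := by
  have h := (((hasDerivAt_id x).const_add a).pow p).inv (pow_ne_zero p hx)
  simp only [one_div]
  refine h.congr_deriv ?_
  simp only [id]
  rcases p with _ | p
  · simp
  · simp only [Nat.add_sub_cancel]
    simp only [Pi.pow_apply]
    field_simp
    ring

theorem hasDerivAt_hurwitzSeries {p : ℕ} (hp : 2 ≤ p) {x : ℝ} (hx : 0 < x) :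
    HasDerivAt (hurwitzSeries p) (-p * hurwitzSeries (p + 1) x) x := by
  -- On `(x/2, ∞)` the differentiated terms are dominated by their values at `x/2`, which permits
  -- termwise differentiation.
  have hx2 : 0 < x / 2 := half_pos hx
  have hu : Summable fun n : ℕ => (p : ℝ) * (1 / ((n : ℝ) + x / 2) ^ (p + 1)) :=
    (summable_one_div_nat_add_pow (by omega) hx2).mul_left _
  have hg : ∀ (n : ℕ) (y : ℝ), y ∈ Ioi (x / 2) →
      HasDerivAt (fun z => 1 / ((n : ℝ) + z) ^ p) (-p * (1 / ((n : ℝ) + y) ^ (p + 1))) y := by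
    intro n y hy
    have hy0 : 0 < y := hx2.trans hy
    exact hasDerivAt_one_div_add_pow n p (by positivity)
  have hg' : ∀ (n : ℕ) (y : ℝ), y ∈ Ioi (x / 2) →
      ‖-(p : ℝ) * (1 / ((n : ℝ) + y) ^ (p + 1))‖ ≤ p * (1 / ((n : ℝ) + x / 2) ^ (p + 1)) := by
    intro n y hy
    have hy0 : 0 < y := hx2.trans hy
    have hy' : x / 2 < y := hy
    rw [norm_mul, norm_neg, Real.norm_natCast, Real.norm_of_nonneg (by positivity)]
    gcongr
  have h := hasDerivAt_tsum_of_isPreconnected hu isOpen_Ioi isPreconnected_Ioi hg hg'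
    (half_lt_self hx) (summable_one_div_nat_add_pow hp hx) (half_lt_self hx)
  rw [tsum_mul_left] at h
  exact h

theorem hasDerivAt_realDigamma {x : ℝ} (hx : 0 < x) :
    HasDerivAt realDigamma (hurwitzSeries 2 x) x := by
  have hx2 : 0 < x / 2 := half_pos hx
  have h : HasDerivAt (fun y => ∑' n : ℕ, (1 / ((n : ℝ) + 1) - 1 / ((n : ℝ) + y)))
      (hurwitzSeries 2 x) x := by
    have hg : ∀ (n : ℕ) (y : ℝ), y ∈ Ioi (x / 2) →
        HasDerivAt (fun z => 1 / ((n : ℝ) + 1) - 1 / ((n : ℝ) + z))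
          (1 / ((n : ℝ) + y) ^ 2) y := by
      intro n y hy
      have hy0 : 0 < y := hx2.trans hy
      simpa using (hasDerivAt_one_div_add_pow n 1 (by positivity : (n : ℝ) + y ≠ 0)).const_sub
        (1 / ((n : ℝ) + 1))
    have hg' : ∀ (n : ℕ) (y : ℝ), y ∈ Ioi (x / 2) →
        ‖1 / ((n : ℝ) + y) ^ 2‖ ≤ 1 / ((n : ℝ) + x / 2) ^ 2 := by
      intro n y hy
      have hy0 : 0 < y := hx2.trans hy
      have hy' : x / 2 < y := hy
      rw [Real.norm_of_nonneg (by positivity)]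
      gcongr
    exact hasDerivAt_tsum_of_isPreconnected (summable_one_div_nat_add_pow le_rfl hx2) isOpen_Ioi
      isPreconnected_Ioi hg hg' (half_lt_self hx) (summable_one_div_sub_one_div hx)
      (half_lt_self hx)
  refine (h.sub_const Real.eulerMascheroniConstant).congr_of_eventuallyEq ?_
  filter_upwards [lt_mem_nhds hx] with y hy
  rw [(hasSum_realDigamma hy).tsum_eq]
  ring

theorem iteratedDeriv_realDigamma (j : ℕ) {x : ℝ} (hx : 0 < x) :
    iteratedDeriv (j + 1) realDigamma x =
      (-1) ^ j * (Nat.factorial (j + 1) : ℝ) * hurwitzSeries (j + 2) x := by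
  induction j generalizing x with
  | zero => simp [iteratedDeriv_one, (hasDerivAt_realDigamma hx).deriv]
  | succ j ih =>
    rw [iteratedDeriv_succ]
    have h : iteratedDeriv (j + 1) realDigamma =ᶠ[𝓝 x] fun y =>
        (-1) ^ j * (Nat.factorial (j + 1) : ℝ) * hurwitzSeries (j + 2) y := by
      filter_upwards [lt_mem_nhds hx] with y hy using ih hy
    rw [h.deriv_eq, ((hasDerivAt_hurwitzSeries (by omega) hx).const_mul _).deriv,
      Nat.factorial_succ (j + 1)]
    push_cast
    ring

theorem shiftedHarmonic_eq_hurwitzSeries {m : ℕ} (hm : 2 ≤ m) {β : ℝ} (hβ : -1 < β) :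
    shiftedHarmonic m β = hurwitzSeries m 1 - hurwitzSeries m (β + 1) := by
  obtain ⟨j, rfl⟩ := Nat.exists_eq_add_of_le' hm
  rw [shiftedHarmonic, if_neg (by omega), show j + 2 - 1 = j + 1 from rfl,
    iteratedDeriv_realDigamma j (by linarith), iteratedDeriv_realDigamma j one_pos]
  have hf : (Nat.factorial (j + 1) : ℝ) ≠ 0 := by exact_mod_cast Nat.factorial_ne_zero _
  have hs : ((-1 : ℝ) ^ j) * (-1) ^ j = 1 := by rw [← mul_pow]; simp
  field_simp
  rw [pow_succ]
  linear_combination (hurwitzSeries (j + 2) 1 - hurwitzSeries (j + 2) (β + 1)) * hs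

theorem realZeta_eq_hurwitzSeries {m : ℕ} (hm : 2 ≤ m) : realZeta m = hurwitzSeries m 1 := by
  rw [realZeta, zeta_nat_eq_tsum_of_gt_one (by omega), hurwitzSeries]
  have hs : Summable fun n : ℕ => 1 / (n : ℝ) ^ m := Real.summable_one_div_nat_pow.2 (by omega)
  have : (∑' n : ℕ, 1 / (n : ℂ) ^ m) = ((∑' n : ℕ, 1 / (n : ℝ) ^ m : ℝ) : ℂ) := by push_cast; rfl
  -- The term `n = 0` is `1/0 = 0` by convention, so the index may be shifted.
  rw [this, Complex.ofReal_re, hs.tsum_eq_zero_add]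
  simp [show m ≠ 0 by omega]

theorem shiftedHarmonic_eq_add {m : ℕ} (hm : 1 ≤ m) {β : ℝ} (hβ : 0 < β) :
    shiftedHarmonic m β = shiftedHarmonic m (β - 1) + 1 / β ^ m := by
  rcases hm.eq_or_lt with rfl | hm
  · simp only [shiftedHarmonic, if_true, sub_add_cancel, realDigamma_add_one hβ]
    ring
  · rw [shiftedHarmonic_eq_hurwitzSeries hm (by linarith),
      shiftedHarmonic_eq_hurwitzSeries hm (by linarith), sub_add_cancel,
      hurwitzSeries_eq_add hm hβ]
    ring

theorem hasSum_shiftedHarmonic_one {β : ℝ} (hβ : -1 < β) :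
    HasSum (fun n : ℕ => 1 / ((n : ℝ) + 1) - 1 / ((n : ℝ) + (β + 1))) (shiftedHarmonic 1 β) := by
  simpa [shiftedHarmonic] using hasSum_realDigamma (by linarith : 0 < β + 1)

theorem hasSum_zeta_sub_shiftedHarmonic {m : ℕ} (hm : 2 ≤ m) {β : ℝ} (hβ : -1 < β) :
    HasSum (fun n : ℕ => 1 / ((n : ℝ) + (β + 1)) ^ m) (realZeta m - shiftedHarmonic m β) := by
  rw [shiftedHarmonic_eq_hurwitzSeries hm hβ, realZeta_eq_hurwitzSeries hm, sub_sub_cancel]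
  exact hasSum_hurwitzSeries hm (by linarith)

theorem shiftedHarmonic_le_zeta {m : ℕ} (hm : 2 ≤ m) {β : ℝ} (hβ : -1 < β) :
    shiftedHarmonic m β ≤ realZeta m := by
  have h := (hasSum_zeta_sub_shiftedHarmonic hm hβ).nonneg fun n => by
    have : 0 < (n : ℝ) + (β + 1) := by have : (0 : ℝ) ≤ n := n.cast_nonneg
                                       linarith
    positivity
  linarith

theorem shiftedHarmonic_nonneg {m : ℕ} (hm : 2 ≤ m) {β : ℝ} (hβ : 0 ≤ β) :
    0 ≤ shiftedHarmonic m β := by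
  rw [shiftedHarmonic_eq_hurwitzSeries hm (by linarith), sub_nonneg]
  refine hasSum_le (fun n => ?_) (hasSum_hurwitzSeries hm (by linarith : 0 < β + 1))
    (hasSum_hurwitzSeries hm one_pos)
  gcongr
  linarith

/-! ### The series for consecutive shifts -/

/-- With `t = n+1`: `1/(t(t+β)^3) = (1/t - 1/(t+β))/β^3 - 1/(β(t+β))^2 - 1/(β(t+β)^3)`. -/
theorem hasSum_one_div_mul_add_cube {β : ℝ} (hβ : 0 < β) :
    HasSum (fun n : ℕ => 1 / (((n : ℝ) + 1) * ((n : ℝ) + (β + 1)) ^ 3))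
      (shiftedHarmonic 1 β / β ^ 3 - (realZeta 2 - shiftedHarmonic 2 β) / β ^ 2
        - (realZeta 3 - shiftedHarmonic 3 β) / β) := by
  have h := (((hasSum_shiftedHarmonic_one (by linarith : -1 < β)).div_const (β ^ 3)).sub
    ((hasSum_zeta_sub_shiftedHarmonic le_rfl (by linarith : -1 < β)).div_const (β ^ 2))).sub
    ((hasSum_zeta_sub_shiftedHarmonic (m := 3) (by norm_num) (by linarith : -1 < β)).div_const β)
  refine h.congr_fun fun n => ?_
  have : (n : ℝ) + (β + 1) ≠ 0 := by positivity
  field_simp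
  ring

theorem sum_range_shiftedHarmonic_three {β : ℝ} (hβ : 0 < β) (q N : ℕ) :
    ∑ n ∈ Finset.range N, shiftedHarmonic 3 (((n + 1 : ℕ) : ℝ) + (β + q)) *
        (1 / (((n + 1 : ℕ) : ℝ) + q) - 1 / (((n + 1 : ℕ) : ℝ) + (q + 1))) =
      ∑ m ∈ Finset.range (N + q), 1 / (((m : ℝ) + 1) * ((m : ℝ) + (β + 1)) ^ 3)
        - ∑ j ∈ Finset.Icc 1 q, shiftedHarmonic 3 (β + j) / j
        + ∑ j ∈ Finset.Icc 1 (q + 1), shiftedHarmonic 3 (β - 1 + j) / j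
        - shiftedHarmonic 3 (β + q + N) / ((N : ℝ) + q + 1) := by
  have hrec : ∀ m : ℕ, 1 / (((m : ℝ) + 1) * ((m : ℝ) + (β + 1)) ^ 3) =
      shiftedHarmonic 3 (β + (m + 1)) / (m + 1) - shiftedHarmonic 3 (β + m) / (m + 1) := by
    intro m
    rw [shiftedHarmonic_eq_add (m := 3) (by norm_num) (by positivity : 0 < β + ((m : ℝ) + 1)),
      show β + ((m : ℝ) + 1) - 1 = β + m by ring]
    have : (m : ℝ) + (β + 1) ≠ 0 := by positivity
    have : β + ((m : ℝ) + 1) ≠ 0 := by positivity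
    rw [show (m : ℝ) + (β + 1) = β + (m + 1) by ring]
    field_simp
    ring
  induction N with
  | zero =>
    simp only [Finset.range_zero, Finset.sum_empty, zero_add, Nat.cast_zero, add_zero]
    have hI : ∀ (M : ℕ) (f : ℕ → ℝ), ∑ j ∈ Finset.Icc 1 M, f j = ∑ m ∈ Finset.range M, f (m + 1) := by
      intro M f
      rw [Finset.range_eq_Ico, Finset.sum_Ico_add' f 0 M 1]
      rfl
    rw [Finset.sum_congr rfl fun m _ => hrec m, Finset.sum_sub_distrib, hI, hI, Finset.sum_range_succ]
    push_cast
    simp only [show ∀ m : ℝ, β - 1 + (m + 1) = β + m by intro m; ring]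
    ring
  | succ N ih =>
    rw [Finset.sum_range_succ, ih, show N + 1 + q = N + q + 1 by ring, Finset.sum_range_succ, hrec]
    push_cast
    rw [show (N : ℝ) + 1 + (β + q) = β + q + (N + 1) by ring,
      show β + ((N : ℝ) + q + 1) = β + q + (N + 1) by ring,
      show β + ((N : ℝ) + q) = β + q + N by ring,
      show (N : ℝ) + 1 + q = N + q + 1 by ring,
      show (N : ℝ) + 1 + (q + 1) = N + 1 + q + 1 by ring]
    ring

theorem hasSum_shiftedHarmonic_three {β : ℝ} (hβ : 1 < β) (q : ℕ) :
    HasSum (fun n : ℕ => shiftedHarmonic 3 (((n + 1 : ℕ) : ℝ) + (β + q)) *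
        (1 / (((n + 1 : ℕ) : ℝ) + q) - 1 / (((n + 1 : ℕ) : ℝ) + (q + 1))))
      (shiftedHarmonic 1 β / β ^ 3 - (realZeta 2 - shiftedHarmonic 2 β) / β ^ 2
        - (realZeta 3 - shiftedHarmonic 3 β) / β
        - ∑ j ∈ Finset.Icc 1 q, shiftedHarmonic 3 (β + j) / j
        + ∑ j ∈ Finset.Icc 1 (q + 1), shiftedHarmonic 3 (β - 1 + j) / j) := by
  have hβ0 : 0 < β := by linarith
  -- The terms are nonnegative, so the limit of partial sums suffices; the boundary term vanishes
  -- because `H^(3) ≤ ζ(3)`.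
  rw [hasSum_iff_tendsto_nat_of_nonneg]
  · have hlim : Tendsto (fun N : ℕ => shiftedHarmonic 3 (β + q + N) / ((N : ℝ) + q + 1))
        atTop (𝓝 0) := by
      have hden : Tendsto (fun N : ℕ => realZeta 3 / ((N : ℝ) + (q + 1))) atTop (𝓝 0) :=
        tendsto_const_nhds.div_atTop
          (tendsto_atTop_add_const_right _ _ tendsto_natCast_atTop_atTop)
      simp only [← add_assoc] at hden
      refine squeeze_zero (fun N => ?_) (fun N => ?_) hden
      · exact div_nonneg (shiftedHarmonic_nonneg (by norm_num) (by positivity)) (by positivity)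
      · have : -1 < β + q + N := lt_of_lt_of_le (by norm_num : (-1 : ℝ) < 0) (by positivity)
        gcongr
        exact shiftedHarmonic_le_zeta (by norm_num) this
    have hsum := ((hasSum_one_div_mul_add_cube hβ0).tendsto_sum_nat).comp (tendsto_add_atTop_nat q)
    have h := ((hsum.sub_const (∑ j ∈ Finset.Icc 1 q, shiftedHarmonic 3 (β + j) / j)).add_const
      (∑ j ∈ Finset.Icc 1 (q + 1), shiftedHarmonic 3 (β - 1 + j) / j)).sub hlim
    rw [sub_zero] at h
    exact h.congr fun N => (sum_range_shiftedHarmonic_three hβ0 q N).symm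
  · intro n
    refine mul_nonneg (shiftedHarmonic_nonneg (by norm_num) (by positivity)) ?_
    rw [sub_nonneg]
    gcongr
    linarith

/-- The terms of the closed form that depend on one of the two shifts `r`, `k` only. -/
noncomputable def shiftedHarmonicClosedForm (α : ℝ) (q : ℕ) : ℝ :=
  ((q : ℝ) - α) * ∑ j ∈ Finset.Icc 1 q,
      shiftedHarmonic 3 (α + (j : ℝ) - (q : ℝ)) / ((j : ℝ) * (α + (j : ℝ) - (q : ℝ)))
    + 3 * shiftedHarmonic 4 (α - q) - shiftedHarmonic 2 (α - q) * realZeta 2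
    - shiftedHarmonic 1 (α - q) * realZeta 3 + shiftedHarmonic 2 (α - q) ^ 2
    + 2 * (shiftedHarmonic 1 (α - q) * shiftedHarmonic 3 (α - q))

/-- From `(q-α)/(j(α+j-q)) = 1/(α-q+j) - 1/j`. Reindexing by `i = q-j` makes the first sum gain a
single term when `q` increases by 1. -/
theorem sub_mul_sum_shiftedHarmonic_three {α : ℝ} {q : ℕ} (hq : (q : ℝ) < α) :
    ((q : ℝ) - α) * ∑ j ∈ Finset.Icc 1 q,
      shiftedHarmonic 3 (α + (j : ℝ) - (q : ℝ)) / ((j : ℝ) * (α + (j : ℝ) - (q : ℝ))) =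
    ∑ i ∈ Finset.range q, shiftedHarmonic 3 (α - i) / (α - i)
      - ∑ j ∈ Finset.Icc 1 q, shiftedHarmonic 3 (α - q + j) / j := by
  have hI : ∑ i ∈ Finset.range q, shiftedHarmonic 3 (α - i) / (α - i) =
      ∑ j ∈ Finset.Icc 1 q, shiftedHarmonic 3 (α - q + j) / (α - q + j) := by
    refine Finset.sum_bij' (fun i _ => q - i) (fun j _ => q - j) ?_ ?_ ?_ ?_ ?_
    · intro i hi
      simp only [Finset.mem_range, Finset.mem_Icc] at *
      omega
    · intro j hj
      simp only [Finset.mem_range, Finset.mem_Icc] at *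
      omega
    · intro i hi
      simp only [Finset.mem_range] at hi
      omega
    · intro j hj
      simp only [Finset.mem_Icc] at hj
      omega
    · intro i hi
      rw [Nat.cast_sub (Finset.mem_range.1 hi).le, show α - q + ((q : ℝ) - i) = α - i by ring]
  rw [hI, ← Finset.sum_sub_distrib, Finset.mul_sum]
  refine Finset.sum_congr rfl fun j hj => ?_
  have hj0 : (0 : ℝ) < j := by exact_mod_cast (Finset.mem_Icc.1 hj).1
  have hq0 : 0 < α - q := sub_pos.2 hq
  rw [show α + (j : ℝ) - q = α - q + j by ring]
  have : α - q + (j : ℝ) ≠ 0 := by positivity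
  field_simp
  ring

theorem hasSum_shiftedHarmonic_three_consecutive {α : ℝ} {q : ℕ} (hq : (q : ℝ) + 1 < α) :
    HasSum (fun n : ℕ => shiftedHarmonic 3 (((n + 1 : ℕ) : ℝ) + α) *
        (1 / (((n + 1 : ℕ) : ℝ) + q) - 1 / (((n + 1 : ℕ) : ℝ) + (q + 1))))
      (shiftedHarmonicClosedForm α q - shiftedHarmonicClosedForm α (q + 1)
        - shiftedHarmonic 2 (α - q) / (α - q) ^ 2 - shiftedHarmonic 1 (α - q) / (α - q) ^ 3) := by
  have h := hasSum_shiftedHarmonic_three (by linarith : 1 < α - q) q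
  rw [sub_add_cancel] at h
  convert h using 1
  have hq0 : 0 < α - q := by linarith
  have h1 := shiftedHarmonic_eq_add (m := 1) le_rfl hq0
  have h2 := shiftedHarmonic_eq_add (m := 2) (by norm_num) hq0
  have h3 := shiftedHarmonic_eq_add (m := 3) (by norm_num) hq0
  have h4 := shiftedHarmonic_eq_add (m := 4) (by norm_num) hq0
  rw [shiftedHarmonicClosedForm, shiftedHarmonicClosedForm,
    sub_mul_sum_shiftedHarmonic_three (by linarith : (q : ℝ) < α),
    sub_mul_sum_shiftedHarmonic_three (by push_cast; exact hq : ((q + 1 : ℕ) : ℝ) < α),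
    Finset.sum_range_succ]
  push_cast
  -- With every order expressed at `α-q-1`, the claim is a rational identity.
  rw [show α - ((q : ℝ) + 1) = α - q - 1 by ring, h1, h2, h3, h4]
  field_simp
  ring

theorem sum_Ico_eq_sum_Icc_sub (f : ℝ → ℝ) (α : ℝ) {r k : ℕ} (hrk : r ≤ k) :
    ∑ q ∈ Finset.Ico r k, f (α - q) = ∑ j ∈ Finset.Icc 1 (k - r), f (α + j - k) := by
  refine Finset.sum_bij' (fun i _ => k - i) (fun j _ => k - j) ?_ ?_ ?_ ?_ ?_
  · intro i hi
    simp only [Finset.mem_Ico, Finset.mem_Icc] at *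
    omega
  · intro j hj
    simp only [Finset.mem_Ico, Finset.mem_Icc] at *
    omega
  · intro i hi
    simp only [Finset.mem_Ico] at hi
    omega
  · intro j hj
    simp only [Finset.mem_Icc] at hj
    omega
  · intro i hi
    rw [Nat.cast_sub (Finset.mem_Ico.1 hi).2.le, show α + ((k : ℝ) - i) - k = α - i by ring]

theorem corollary2p10 (r k : ℕ) (α : ℝ) (hrk : r < k) (hα : (k : ℝ) < α) :
    HasSum
      (fun n : ℕ => shiftedHarmonic 3 (((n + 1 : ℕ) : ℝ) + α) /
        ((((n + 1 : ℕ) : ℝ) + (r : ℝ)) * (((n + 1 : ℕ) : ℝ) + (k : ℝ))))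
      (1 / ((k : ℝ) - (r : ℝ)) *
        (((r : ℝ) - α) * ∑ j ∈ Finset.Icc 1 r,
            shiftedHarmonic 3 (α + (j : ℝ) - (r : ℝ)) / ((j : ℝ) * (α + (j : ℝ) - (r : ℝ)))
          - ((k : ℝ) - α) * ∑ j ∈ Finset.Icc 1 k,
            shiftedHarmonic 3 (α + (j : ℝ) - (k : ℝ)) / ((j : ℝ) * (α + (j : ℝ) - (k : ℝ)))
          - ∑ j ∈ Finset.Icc 1 (k - r),
            shiftedHarmonic 2 (α + (j : ℝ) - (k : ℝ)) / (α + (j : ℝ) - (k : ℝ)) ^ 2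
          - ∑ j ∈ Finset.Icc 1 (k - r),
            shiftedHarmonic 1 (α + (j : ℝ) - (k : ℝ)) / (α + (j : ℝ) - (k : ℝ)) ^ 3
          + 3 * (shiftedHarmonic 4 (α - (r : ℝ)) - shiftedHarmonic 4 (α - (k : ℝ)))
          + (shiftedHarmonic 2 (α - (k : ℝ)) - shiftedHarmonic 2 (α - (r : ℝ))) * realZeta 2
          + (shiftedHarmonic 1 (α - (k : ℝ)) - shiftedHarmonic 1 (α - (r : ℝ))) * realZeta 3
          + (shiftedHarmonic 2 (α - (r : ℝ)) ^ 2 - shiftedHarmonic 2 (α - (k : ℝ)) ^ 2)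
          + 2 * (shiftedHarmonic 1 (α - (r : ℝ)) * shiftedHarmonic 3 (α - (r : ℝ))
              - shiftedHarmonic 1 (α - (k : ℝ)) * shiftedHarmonic 3 (α - (k : ℝ))))) := by
  have hkr : (0 : ℝ) < k - r := sub_pos.2 (by exact_mod_cast hrk)
  have h := hasSum_sum (s := Finset.Ico r k) fun q hq =>
    hasSum_shiftedHarmonic_three_consecutive (α := α) (q := q) (by
      have : ((q + 1 : ℕ) : ℝ) ≤ k := by exact_mod_cast (Finset.mem_Ico.1 hq).2
      push_cast at this
      linarith)
  have htel : ∀ F : ℕ → ℝ, ∑ q ∈ Finset.Ico r k, (F q - F (q + 1)) = F r - F k := fun F => by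
    rw [← neg_sub (F k), ← Finset.sum_Ico_sub F hrk.le, ← Finset.sum_neg_distrib]
    simp
  convert h.mul_left (1 / ((k : ℝ) - r)) using 1
  · rfl
  · ext n
    have ht := htel fun q => 1 / (((n + 1 : ℕ) : ℝ) + q)
    push_cast at ht ⊢
    rw [← Finset.mul_sum, ht]
    field_simp
    ring
  · rw [Finset.sum_sub_distrib, Finset.sum_sub_distrib, htel,
      sum_Ico_eq_sum_Icc_sub (fun x => shiftedHarmonic 2 x / x ^ 2) α hrk.le,
      sum_Ico_eq_sum_Icc_sub (fun x => shiftedHarmonic 1 x / x ^ 3) α hrk.le,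
      shiftedHarmonicClosedForm, shiftedHarmonicClosedForm]
    ring
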